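/- Let $q$ be a prime power, let $V$ be an $n$-dimensional vector space over the finite field $\mathbb{F}_q$, and for an integer $m\ge 0$ write ${V\brack m}$ for the set of all $m$-dimensional subspaces of $V$. A family $\mathcal{F}\subseteq{V\brack k}$ is called $t$-intersecting if $\dim(F_1\cap F_2)\geq t$ for all $F_1,F_2\in\mathcal{F}$, and almost $t$-intersecting if for each $F\in\mathcal{F}$ there is at most one $F'\in\mathcal{F}$ with $\dim(F\cap F')<t$. Let $n$, $k$ and $t$ be positive integers with $k\geq t+1$ and $n\geq 2k+1+\delta_{2,q}(1-\delta_{k,t+1})$, where $\delta$ is the Kronecker delta (that is, $n\ge 2k+2$ if $q=2$ and $k\neq t+1$, and $n\geq 2k+1$ otherwise). If $\mathcal{F}\subseteq{V\brack k}$ is an almost $t$-intersecting family of maximum size among all almost $t$-intersecting families contained in ${V\brack k}$, then there exists $E\in{V\brack t}$ such that $$\mathcal{F}=\left\{F\in{V\brack k}: E\subseteq F\right\}.$$ In particular, $\mathcal{F}$ is $t$-intersecting. -/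

import Mathlib

namespace AlmostIntersecting

variable {K V : Type*} [Field K] [AddCommGroup V] [Module K V]

/-- The family of all `k`-dimensional subspaces of `V`. -/
def subspacesOfDim (K V : Type*) [Field K] [AddCommGroup V] [Module K V] (k : ℕ) :
    Set (Submodule K V) :=
  {F | Module.finrank K F = k}

/-- Any two members of the family (possibly equal) meet in dimension at least `t`. -/
def IsTIntersecting (t : ℕ) (𝓕 : Set (Submodule K V)) : Prop :=
  ∀ F₁ ∈ 𝓕, ∀ F₂ ∈ 𝓕, t ≤ Module.finrank K (F₁ ⊓ F₂ : Submodule K V)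

/-- For each member `F` there is at most one member `F'` with `dim (F ∩ F') < t`. -/
def IsAlmostTIntersecting (t : ℕ) (𝓕 : Set (Submodule K V)) : Prop :=
  ∀ F ∈ 𝓕, {F' ∈ 𝓕 | Module.finrank K (F ⊓ F' : Submodule K V) < t}.Subsingleton

/-- `𝓕` is an almost `t`-intersecting family of `k`-subspaces of `V`, and no such family has more
members. (Over a finite field and in finite dimension all families are finite, so `Set.ncard` is
the true cardinality.) -/
def IsMaximumAlmostTIntersecting (k t : ℕ) (𝓕 : Set (Submodule K V)) : Prop :=
  𝓕 ⊆ subspacesOfDim K V k ∧ IsAlmostTIntersecting t 𝓕 ∧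
    ∀ 𝓖 : Set (Submodule K V), 𝓖 ⊆ subspacesOfDim K V k → IsAlmostTIntersecting t 𝓖 →
      𝓖.ncard ≤ 𝓕.ncard

/-- The Kronecker delta on natural numbers. -/
def delta (i j : ℕ) : ℕ := if i = j then 1 else 0

end AlmostIntersecting

/-! Call `T` an almost `t`-cover of `𝓕` if at most one `F ∈ 𝓕` meets it in dimension less than `t`;
every member of `𝓕` is one. If `B ∈ 𝓕` meets `U` in dimension less than `t`, then all members of
`𝓕` through `U`, except possibly one, contain one of `[k - t + 1]` subspaces `U ⊔ L`, where `L` runs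
over the points of a fixed subspace of `B` disjoint from `U`. Suppose that no `t`-subspace lies in
all members of `𝓕`, and let `T` be an almost `t`-cover of least dimension `t + s > t`. Then every
`U` with `t ≤ dim U < t + s` has such a `B`. Starting from the `t`-subspaces of `T`, one of which
lies in each member of `𝓕` with at most one exception, and extending `s` times gives
`|𝓕| ≤ 1 + ([t + 1] ([k - t + 1] + 1)) ^ s * [n - t - s, k - t - s]`.
Since `[n - t, k - t] ≥ q ^ ((n - k) * s) * [n - t - s, k - t - s]`, this is less than the size
`[n - t, k - t]` of the family of all `k`-subspaces through a fixed `t`-subspace; for `k = t + 1`,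
where this estimate can be too weak, `[n - t, 1]` is compared directly. -/

namespace AlmostIntersecting

open Module

section QAnalogues

/-- The `q`-analogue `[m] = 1 + q + ⋯ + q ^ (m - 1)` of `m`, the number of points of a projective
space of dimension `m - 1` over a field with `q` elements. -/
def qNum (q m : ℕ) : ℕ := ∑ i ∈ Finset.range m, q ^ i

/-- The `q`-analogue `[m]! = [1] [2] ⋯ [m]` of `m!`. -/
def qFactorial (q m : ℕ) : ℕ := ∏ i ∈ Finset.range m, qNum q (i + 1)

/-- The Gaussian binomial coefficient `[b + d, b]`, defined by the `q`-Pascal recursion. It is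
parametrized by the dimension `b` and the codimension `d`, so that no subtraction occurs. -/
def gaussBinom (q : ℕ) : ℕ → ℕ → ℕ
  | 0, _ => 1
  | _ + 1, 0 => 1
  | b + 1, d + 1 => gaussBinom q b (d + 1) + q ^ (b + 1) * gaussBinom q (b + 1) d

variable {q : ℕ}

@[simp]
lemma qNum_zero : qNum q 0 = 0 := by simp [qNum]

@[simp]
lemma qNum_one : qNum q 1 = 1 := by simp [qNum]

lemma qNum_add (m n : ℕ) : qNum q (m + n) = qNum q m + q ^ m * qNum q n := by
  simp only [qNum, Finset.sum_range_add, pow_add, Finset.mul_sum]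

lemma qNum_succ (m : ℕ) : qNum q (m + 1) = qNum q m + q ^ m := by
  simp [qNum_add]

lemma qNum_succ' (m : ℕ) : qNum q (m + 1) = 1 + q * qNum q m := by
  simp [add_comm m, qNum_add]

lemma qNum_succ_pos (m : ℕ) : 0 < qNum q (m + 1) := by
  rw [qNum_succ']
  positivity

lemma mul_qNum_add_one (p m : ℕ) : p * qNum (p + 1) m + 1 = (p + 1) ^ m := by
  rw [mul_comm]
  exact geom_sum_mul_add p m

lemma mul_qNum_lt_pow {p : ℕ} (hp : p < q) (m : ℕ) : p * qNum q m < q ^ m := by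
  obtain ⟨q, rfl⟩ := Nat.exists_eq_succ_of_ne_zero (Nat.ne_zero_of_lt hp)
  have hpq : p * qNum (q + 1) m ≤ q * qNum (q + 1) m := by gcongr; omega
  have := mul_qNum_add_one q m
  rw [Nat.succ_eq_add_one]
  omega

lemma qFactorial_succ (m : ℕ) : qFactorial q (m + 1) = qFactorial q m * qNum q (m + 1) :=
  Finset.prod_range_succ _ _

lemma qFactorial_pos (m : ℕ) : 0 < qFactorial q m :=
  Finset.prod_pos fun i _ => qNum_succ_pos i

lemma gaussBinom_mul_qFactorial_mul_qFactorial (b d : ℕ) :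
    gaussBinom q b d * (qFactorial q b * qFactorial q d) = qFactorial q (b + d) := by
  induction b, d using gaussBinom.induct with
  | case1 d => simp [gaussBinom, qFactorial]
  | case2 b => simp [gaussBinom, qFactorial]
  | case3 b d ihb ihd =>
    have hsplit : qNum q (b + 1 + d + 1) = qNum q (b + 1) + q ^ (b + 1) * qNum q (d + 1) := by
      rw [add_assoc, qNum_add]
    rw [show b + (d + 1) = b + 1 + d by omega, qFactorial_succ] at ihb
    rw [qFactorial_succ b] at ihd
    rw [gaussBinom, Nat.succ_eq_add_one, Nat.succ_eq_add_one, ← add_assoc,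
      qFactorial_succ (b + 1 + d), hsplit, qFactorial_succ b, qFactorial_succ d]
    linear_combination qNum q (b + 1) * ihb + q ^ (b + 1) * qNum q (d + 1) * ihd

lemma gaussBinom_comm (b d : ℕ) : gaussBinom q b d = gaussBinom q d b := by
  refine Nat.eq_of_mul_eq_mul_right
    (Nat.mul_pos (qFactorial_pos b) (qFactorial_pos d) : 0 < qFactorial q b * qFactorial q d) ?_
  rw [gaussBinom_mul_qFactorial_mul_qFactorial, mul_comm (qFactorial q b),
    gaussBinom_mul_qFactorial_mul_qFactorial, add_comm]

lemma gaussBinom_succ_left_mul (b d : ℕ) :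
    gaussBinom q (b + 1) d * qNum q (b + 1) = gaussBinom q b d * qNum q (b + 1 + d) := by
  refine Nat.eq_of_mul_eq_mul_right
    (Nat.mul_pos (qFactorial_pos b) (qFactorial_pos d) : 0 < qFactorial q b * qFactorial q d) ?_
  have hb := gaussBinom_mul_qFactorial_mul_qFactorial (q := q) b d
  have hb' := gaussBinom_mul_qFactorial_mul_qFactorial (q := q) (b + 1) d
  rw [qFactorial_succ, show b + 1 + d = b + d + 1 by omega, qFactorial_succ] at hb'
  rw [show b + 1 + d = b + d + 1 by omega]
  linear_combination hb' - qNum q (b + d + 1) * hb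

lemma gaussBinom_succ_right_mul (b d : ℕ) :
    gaussBinom q b (d + 1) * qNum q (d + 1) = gaussBinom q b d * qNum q (b + (d + 1)) := by
  rw [gaussBinom_comm, gaussBinom_succ_left_mul, gaussBinom_comm, add_comm b]

@[simp]
lemma gaussBinom_zero_left (d : ℕ) : gaussBinom q 0 d = 1 := by
  rw [gaussBinom]

@[simp]
lemma gaussBinom_zero_right (b : ℕ) : gaussBinom q b 0 = 1 := by
  rw [gaussBinom_comm, gaussBinom_zero_left]

lemma gaussBinom_one_left (d : ℕ) : gaussBinom q 1 d = qNum q (d + 1) := by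
  simpa [add_comm] using gaussBinom_succ_left_mul (q := q) 0 d

lemma gaussBinom_pos (b d : ℕ) : 0 < gaussBinom q b d := by
  refine Nat.pos_of_mul_pos_right (b := qFactorial q b * qFactorial q d) ?_
  rw [gaussBinom_mul_qFactorial_mul_qFactorial]
  exact qFactorial_pos _

lemma pow_mul_gaussBinom_le (b d : ℕ) : q ^ d * gaussBinom q b d ≤ gaussBinom q (b + 1) d := by
  refine Nat.le_of_mul_le_mul_right ?_ (qNum_succ_pos (q := q) b)
  calc q ^ d * gaussBinom q b d * qNum q (b + 1)
      = gaussBinom q b d * (q ^ d * qNum q (b + 1)) := by ring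
    _ ≤ gaussBinom q b d * qNum q (b + 1 + d) := by
      rw [add_comm (b + 1) d, qNum_add d]
      gcongr
      exact Nat.le_add_left _ _
    _ = gaussBinom q (b + 1) d * qNum q (b + 1) := (gaussBinom_succ_left_mul b d).symm

lemma pow_pow_mul_gaussBinom_le (b d j : ℕ) :
    (q ^ d) ^ j * gaussBinom q b d ≤ gaussBinom q (b + j) d := by
  induction j with
  | zero => simp
  | succ j ih =>
    calc (q ^ d) ^ (j + 1) * gaussBinom q b d = q ^ d * ((q ^ d) ^ j * gaussBinom q b d) := by ring
      _ ≤ q ^ d * gaussBinom q (b + j) d := by gcongr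
      _ ≤ gaussBinom q (b + j + 1) d := pow_mul_gaussBinom_le _ _

lemma qNum_add_succ_le_mul (m n : ℕ) :
    qNum q (m + (n + 1)) ≤ qNum q (m + 1) * qNum q (n + 1) := by
  calc qNum q (m + (n + 1)) = qNum q (m + 1) + q * (q ^ m * qNum q n) := by
        rw [← add_assoc, add_right_comm, qNum_add, pow_succ]
        ring
    _ ≤ qNum q (m + 1) + q * (qNum q (m + 1) * qNum q n) := by
        gcongr
        rw [qNum_succ]
        exact Nat.le_add_left _ _
    _ = qNum q (m + 1) * qNum q (n + 1) := by
        rw [qNum_succ' n]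
        ring

lemma gaussBinom_le_qNum_pow (b d : ℕ) : gaussBinom q b d ≤ qNum q (b + 1) ^ d := by
  induction d with
  | zero => simp
  | succ d ih =>
    refine Nat.le_of_mul_le_mul_right ?_ (qNum_succ_pos (q := q) d)
    calc gaussBinom q b (d + 1) * qNum q (d + 1)
        = gaussBinom q b d * qNum q (b + (d + 1)) := gaussBinom_succ_right_mul b d
      _ ≤ qNum q (b + 1) ^ d * (qNum q (b + 1) * qNum q (d + 1)) := by
        gcongr
        exact qNum_add_succ_le_mul b d
      _ = qNum q (b + 1) ^ (d + 1) * qNum q (d + 1) := by ring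

lemma one_add_pow_mul_gaussBinom_lt {x j r a : ℕ} (hj : j ≠ 0) (hx : x + 1 < q ^ a) :
    1 + x ^ j * gaussBinom q r a < gaussBinom q (r + j) a := by
  have hpos : 0 < gaussBinom q r a := gaussBinom_pos r a
  calc 1 + x ^ j * gaussBinom q r a ≤ (x ^ j + 1 ^ j) * gaussBinom q r a := by
        rw [one_pow, add_mul]
        omega
    _ ≤ (x + 1) ^ j * gaussBinom q r a := by
        gcongr
        exact pow_add_pow_le x.zero_le zero_le_one hj
    _ < (q ^ a) ^ j * gaussBinom q r a := by gcongr
    _ ≤ gaussBinom q (r + j) a := pow_pow_mul_gaussBinom_le r a j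

lemma qNum_mul_succ_qNum_add_one_lt (hq : 2 ≤ q) {t m : ℕ} (hm : 1 ≤ m) :
    qNum q (t + 1) * (qNum q m + 1) + 1 < q ^ (t + m + 1) := by
  have ht : qNum q (t + 1) + 1 ≤ q ^ (t + 1) := by simpa using mul_qNum_lt_pow hq (t + 1)
  have hm' : qNum q m + 1 ≤ q ^ m := by simpa using mul_qNum_lt_pow hq m
  have hqm : 1 < q ^ m := Nat.one_lt_pow (by omega) hq
  calc qNum q (t + 1) * (qNum q m + 1) + 1 < qNum q (t + 1) * q ^ m + q ^ m :=
        add_lt_add_of_le_of_lt (Nat.mul_le_mul_left _ hm') hqm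
    _ = (qNum q (t + 1) + 1) * q ^ m := by ring
    _ ≤ q ^ (t + 1) * q ^ m := by gcongr
    _ = q ^ (t + m + 1) := by ring

lemma qNum_mul_succ_qNum_add_one_lt_of_three_le (hq : 3 ≤ q) {t m : ℕ} (hm : 2 ≤ m) :
    qNum q (t + 1) * (qNum q m + 1) + 1 < q ^ (t + m) := by
  have ht : 2 * qNum q (t + 1) ≤ 3 * q ^ t := by
    have := mul_qNum_lt_pow hq t
    rw [qNum_succ]
    omega
  have hm' : 2 * qNum q m + 1 ≤ q ^ m := mul_qNum_lt_pow hq m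
  have hqm : 9 ≤ q ^ m := (Nat.pow_le_pow_left hq 2).trans (Nat.pow_le_pow_right (by omega) hm)
  have hqt : 1 ≤ q ^ t := Nat.one_le_pow _ _ (by omega)
  rw [pow_add]
  have hmul : (2 * qNum q (t + 1)) * (2 * qNum q m + 2) ≤ (3 * q ^ t) * (q ^ m + 1) := by
    gcongr ?_ * ?_
    omega
  have hprod : q ^ t * 9 ≤ q ^ t * q ^ m := by gcongr
  linarith only [hmul, hprod, hqt]

lemma one_add_qNum_mul_lt_gaussBinom_one (hq : 2 ≤ q) {t a : ℕ} (ha : t + 2 ≤ a) :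
    1 + qNum q (t + 1) * (qNum q 2 + 1) < gaussBinom q 1 a := by
  have htwo : qNum q 2 = 1 + q := by simp [qNum_succ]
  have hsq : q + 2 ≤ q * q := by nlinarith
  calc 1 + qNum q (t + 1) * (qNum q 2 + 1) = 1 + (q + 2) * qNum q (t + 1) := by
        rw [htwo]
        ring
    _ < 1 + q * (1 + q * qNum q (t + 1)) := by
        rw [mul_add, ← mul_assoc]
        have := Nat.mul_le_mul_right (qNum q (t + 1)) hsq
        omega
    _ = qNum q (t + 3) := by rw [qNum_succ' (t + 2), qNum_succ' (t + 1)]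
    _ ≤ qNum q (a + 1) := Finset.sum_le_sum_of_subset (Finset.range_mono (by omega))
    _ = gaussBinom q 1 a := (gaussBinom_one_left a).symm

lemma one_add_qNum_pow_mul_gaussBinom_lt (hq : 2 ≤ q) {k t a j r : ℕ} (hj : 1 ≤ j)
    (hk : t + j + r = k) (ha : k + 1 ≤ a) (hcases : k = t + 1 ∨ 3 ≤ q ∨ k + 2 ≤ a) :
    1 + (qNum q (t + 1) * (qNum q (j + r + 1) + 1)) ^ j * gaussBinom q r a <
      gaussBinom q (r + j) a := by
  rcases hcases with hk' | hcases
  · obtain ⟨rfl, rfl⟩ : j = 1 ∧ r = 0 := by omega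
    simpa using one_add_qNum_mul_lt_gaussBinom_one hq (by omega)
  · refine one_add_pow_mul_gaussBinom_lt (by omega) ?_
    rcases hcases with hq3 | ha'
    · exact (qNum_mul_succ_qNum_add_one_lt_of_three_le hq3 (by omega)).trans_le
        (Nat.pow_le_pow_right (by omega) (by omega))
    · exact (qNum_mul_succ_qNum_add_one_lt hq (by omega)).trans_le
        (Nat.pow_le_pow_right (by omega) (by omega))

end QAnalogues

section Counting

lemma ncard_mul_eq_ncard_mul {α β : Type*} {s : Set α} {t : Set β} (hs : s.Finite)
    (ht : t.Finite) (r : α → β → Prop) {m n : ℕ} (hm : ∀ a ∈ s, {b ∈ t | r a b}.ncard = m)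
    (hn : ∀ b ∈ t, {a ∈ s | r a b}.ncard = n) : s.ncard * m = t.ncard * n := by
  classical
  lift s to Finset α using hs
  lift t to Finset β using ht
  rw [Set.ncard_coe_finset, Set.ncard_coe_finset]
  refine Finset.card_mul_eq_card_mul r (fun a ha => ?_) fun b hb => ?_
  · rw [← hm a ha, ← Set.ncard_coe_finset, Finset.coe_bipartiteAbove]
    rfl
  · rw [← hn b hb, ← Set.ncard_coe_finset, Finset.coe_bipartiteBelow]
    rfl

lemma ncard_le_ncard_mul_of_subset_biUnion {ι α : Type*} [Finite α] {s : Set α} {t : Set ι}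
    (ht : t.Finite) {f : ι → Set α} {M : ℕ} (hs : s ⊆ ⋃ i ∈ t, f i)
    (hM : ∀ i ∈ t, (f i).ncard ≤ M) : s.ncard ≤ t.ncard * M := by
  lift t to Finset ι using ht
  calc s.ncard ≤ (⋃ i ∈ t, f i).ncard := Set.ncard_le_ncard hs
    _ ≤ ∑ i ∈ t, (f i).ncard := t.set_ncard_biUnion_le f
    _ ≤ t.card * M := by simpa using t.sum_le_card_nsmul _ M hM
    _ = (t : Set ι).ncard * M := by rw [Set.ncard_coe_finset]

end Counting

section Subspaces

variable {K V : Type*} [Field K] [AddCommGroup V] [Module K V]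

lemma exists_le_finrank_eq (W : Submodule K V) {d : ℕ} (hd : d ≤ finrank K W) :
    ∃ E ≤ W, finrank K E = d := by
  obtain ⟨f, hf⟩ := exists_linearIndependent_of_le_finrank hd
  refine ⟨(Submodule.span K (Set.range f)).map W.subtype, Submodule.map_subtype_le _ _, ?_⟩
  rw [Submodule.finrank_map_subtype_eq, finrank_span_eq_card hf, Fintype.card_fin]

lemma finite_submodule (K V : Type*) [Field K] [Finite K] [AddCommGroup V] [Module K V]
    [FiniteDimensional K V] : Finite (Submodule K V) :=
  have : Finite V := Module.finite_of_finite K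
  inferInstance

lemma ncard_subspacesOfDim_le (W : Submodule K V) (d : ℕ) :
    {E ∈ subspacesOfDim K V d | E ≤ W}.ncard = (subspacesOfDim K W d).ncard := by
  rw [← Set.ncard_image_of_injective _ (Submodule.map_injective_of_injective W.subtype_injective)]
  congr 1
  ext E
  simp only [subspacesOfDim, Set.mem_ofPred_eq, Set.mem_image]
  constructor
  · rintro ⟨hE, hEW⟩
    have hmap : (E.comap W.subtype).map W.subtype = E := by
      rwa [Submodule.map_comap_subtype, inf_eq_right]
    exact ⟨E.comap W.subtype, by rw [← Submodule.finrank_map_subtype_eq, hmap, hE], hmap⟩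
  · rintro ⟨H, hH, rfl⟩
    exact ⟨by rw [Submodule.finrank_map_subtype_eq, hH], Submodule.map_subtype_le _ _⟩

lemma ncard_subspacesOfDim_one [Finite K] :
    (subspacesOfDim K V 1).ncard = qNum (Nat.card K) (finrank K V) := by
  rw [qNum, ← Projectivization.card_of_finrank K V rfl,
    Nat.card_congr (Projectivization.equivSubmodule K V)]
  rfl

variable [FiniteDimensional K V]

lemma finrank_sup_of_disjoint {U W : Submodule K V} (h : Disjoint U W) :
    finrank K (U ⊔ W : Submodule K V) = finrank K U + finrank K W := by
  rw [← Submodule.finrank_sup_add_finrank_inf_eq, h.eq_bot, finrank_bot, add_zero]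

lemma exists_le_disjoint_finrank_add_eq (U B : Submodule K V) :
    ∃ C ≤ B, Disjoint U C ∧
      finrank K (B ⊓ U : Submodule K V) + finrank K C = finrank K B := by
  obtain ⟨C, hC⟩ := Submodule.exists_isCompl (U.comap B.subtype)
  refine ⟨C.map B.subtype, Submodule.map_subtype_le _ _, ?_, ?_⟩
  · rw [Submodule.disjoint_def]
    rintro _ hxU ⟨y, hyC, rfl⟩
    simp [Submodule.disjoint_def.1 hC.disjoint y hxU hyC]
  · rw [Submodule.finrank_map_subtype_eq, ← Submodule.finrank_add_eq_of_isCompl hC,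
      ← Submodule.map_comap_subtype, Submodule.finrank_map_subtype_eq]

lemma finrank_add_finrank_map_mkQ {U F : Submodule K V} (h : U ≤ F) :
    finrank K U + finrank K (F.map U.mkQ) = finrank K F := by
  have hquot := (Submodule.quotientQuotientEquivQuotient U F h).finrank_eq
  have hU := U.finrank_quotient_add_finrank
  have hF := F.finrank_quotient_add_finrank
  have hmap := (F.map U.mkQ).finrank_quotient_add_finrank
  omega

lemma ncard_subspacesOfDim_ge (U : Submodule K V) (b : ℕ) :
    {F ∈ subspacesOfDim K V (finrank K U + b) | U ≤ F}.ncard =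
      (subspacesOfDim K (V ⧸ U) b).ncard := by
  rw [← Set.ncard_image_of_injective _ (Submodule.comap_injective_of_surjective U.mkQ_surjective)]
  congr 1
  ext F
  simp only [subspacesOfDim, Set.mem_ofPred_eq, Set.mem_image]
  constructor
  · rintro ⟨hF, hUF⟩
    refine ⟨F.map U.mkQ, ?_, by rwa [Submodule.comap_map_mkQ, sup_eq_right]⟩
    have := finrank_add_finrank_map_mkQ hUF
    omega
  · rintro ⟨H, hH, rfl⟩
    refine ⟨?_, U.le_comap_mkQ H⟩
    rw [← finrank_add_finrank_map_mkQ (U.le_comap_mkQ H),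
      Submodule.map_comap_eq_of_surjective U.mkQ_surjective, hH]

variable [Finite K]

lemma ncard_subspacesOfDim {b d : ℕ} (hV : finrank K V = b + d) :
    (subspacesOfDim K V b).ncard = gaussBinom (Nat.card K) b d := by
  induction b generalizing V with
  | zero =>
    have hbot : subspacesOfDim K V 0 = {⊥} := by
      ext F
      simp [subspacesOfDim]
    rw [hbot, Set.ncard_singleton, gaussBinom_zero_left]
  | succ b ih =>
    have := finite_submodule K V
    have hcount := ncard_mul_eq_ncard_mul (Set.toFinite (subspacesOfDim K V 1))
      (Set.toFinite (subspacesOfDim K V (b + 1))) (· ≤ ·) (m := gaussBinom (Nat.card K) b d)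
      (n := qNum (Nat.card K) (b + 1))
      (fun L (hL : finrank K L = 1) => by
        rw [add_comm b, ← hL, ncard_subspacesOfDim_ge, ih]
        have := L.finrank_quotient_add_finrank
        omega)
      (fun F (hF : finrank K F = b + 1) => by
        rw [ncard_subspacesOfDim_le, ncard_subspacesOfDim_one, hF])
    rw [ncard_subspacesOfDim_one, hV] at hcount
    refine Nat.eq_of_mul_eq_mul_right (qNum_succ_pos (q := Nat.card K) b) ?_
    rw [← hcount, gaussBinom_succ_left_mul, mul_comm]

lemma ncard_subspacesOfDim_ge_eq_gaussBinom {k r a : ℕ} {U : Submodule K V}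
    (hV : finrank K V = k + a) (hU : finrank K U + r = k) :
    {F ∈ subspacesOfDim K V k | U ≤ F}.ncard = gaussBinom (Nat.card K) r a := by
  have := U.finrank_quotient_add_finrank
  rw [← hU, ncard_subspacesOfDim_ge, ncard_subspacesOfDim (d := a) (by omega)]

end Subspaces

section Families

variable {K V : Type*} [Field K] [AddCommGroup V] [Module K V]

/-- `T` is an almost `t`-cover of `𝓕` if at most one member of `𝓕` meets `T` in dimension less than
`t`. A family is almost `t`-intersecting iff each of its members is an almost `t`-cover of it. -/
def IsAlmostCover (t : ℕ) (𝓕 : Set (Submodule K V)) (T : Submodule K V) : Prop :=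
  {F ∈ 𝓕 | finrank K (T ⊓ F : Submodule K V) < t}.Subsingleton

lemma IsAlmostCover.mono {t : ℕ} {𝓕 𝓖 : Set (Submodule K V)} {T : Submodule K V}
    (h : IsAlmostCover t 𝓕 T) (h𝓖 : 𝓖 ⊆ 𝓕) : IsAlmostCover t 𝓖 T :=
  Set.Subsingleton.anti h fun _ hF => ⟨h𝓖 hF.1, hF.2⟩

lemma exists_finrank_inf_lt_of_not_isAlmostCover {t : ℕ} {𝓕 : Set (Submodule K V)}
    {T : Submodule K V} (h : ¬IsAlmostCover t 𝓕 T) :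
    ∃ F ∈ 𝓕, finrank K (T ⊓ F : Submodule K V) < t :=
  (Set.not_subsingleton_iff.1 h).nonempty

lemma IsTIntersecting.isAlmostTIntersecting {t : ℕ} {𝓕 : Set (Submodule K V)}
    (h : IsTIntersecting t 𝓕) : IsAlmostTIntersecting t 𝓕 :=
  fun F hF _ hF' => absurd hF'.2 (h F hF _ hF'.1).not_gt

lemma IsAlmostTIntersecting.exists_minimal_isAlmostCover {𝓕 : Set (Submodule K V)} {k t : ℕ}
    (hint : IsAlmostTIntersecting t 𝓕) (h𝓕 : 𝓕 ⊆ subspacesOfDim K V k) (hne : 𝓕.Nonempty)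
    (hk : t + 1 ≤ k) :
    ∃ T : Submodule K V, IsAlmostCover t 𝓕 T ∧ t + 1 ≤ finrank K T ∧ finrank K T ≤ k ∧
      ∀ U : Submodule K V, t + 1 ≤ finrank K U → finrank K U < finrank K T →
        ¬IsAlmostCover t 𝓕 U := by
  obtain ⟨F, hF⟩ := hne
  have hFk : finrank K F = k := h𝓕 hF
  obtain ⟨T, ⟨hT, htT⟩, hmin⟩ := exists_minimalFor_of_wellFoundedLT
    (fun T : Submodule K V => IsAlmostCover t 𝓕 T ∧ t + 1 ≤ finrank K T)
    (fun T => finrank K T) ⟨F, hint F hF, by omega⟩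
  have hle {U : Submodule K V} (hU : IsAlmostCover t 𝓕 U) (htU : t + 1 ≤ finrank K U) :
      finrank K T ≤ finrank K U :=
    (le_total _ _).elim id fun h => hmin ⟨hU, htU⟩ h
  exact ⟨T, hT, htT, (hle (hint F hF) (by omega)).trans_eq hFk,
    fun U htU hlt hU => (hle hU htU).not_gt hlt⟩

variable [FiniteDimensional K V]

lemma isTIntersecting_of_forall_le {t : ℕ} {𝓕 : Set (Submodule K V)} {E : Submodule K V}
    (hE : finrank K E = t) (h : ∀ F ∈ 𝓕, E ≤ F) : IsTIntersecting t 𝓕 :=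
  fun F₁ h₁ F₂ h₂ => hE ▸ Submodule.finrank_mono (le_inf (h F₁ h₁) (h F₂ h₂))

variable [Finite K]

lemma IsAlmostCover.ncard_le {t : ℕ} {𝓕 : Set (Submodule K V)} {T : Submodule K V}
    (h : IsAlmostCover t 𝓕 T) :
    𝓕.ncard ≤ {F ∈ 𝓕 | t ≤ finrank K (T ⊓ F : Submodule K V)}.ncard + 1 := by
  have := finite_submodule K V
  calc 𝓕.ncard = ({F ∈ 𝓕 | t ≤ finrank K (T ⊓ F : Submodule K V)} ∪
          {F ∈ 𝓕 | finrank K (T ⊓ F : Submodule K V) < t}).ncard := by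
        congr 1
        ext F
        simp only [Set.mem_union, Set.mem_ofPred_eq, ← and_or_left, le_or_gt, and_true]
    _ ≤ {F ∈ 𝓕 | t ≤ finrank K (T ⊓ F : Submodule K V)}.ncard +
          {F ∈ 𝓕 | finrank K (T ⊓ F : Submodule K V) < t}.ncard := Set.ncard_union_le _ _
    _ ≤ {F ∈ 𝓕 | t ≤ finrank K (T ⊓ F : Submodule K V)}.ncard + 1 := by
        gcongr
        exact Set.ncard_le_one_iff_subsingleton.2 h

lemma ncard_le_qNum_mul_of_le_finrank_inf {𝓕 : Set (Submodule K V)} {U B : Submodule K V}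
    {t m M : ℕ}
    (hU : ∀ F ∈ 𝓕, U ≤ F) (hB : ∀ F ∈ 𝓕, t ≤ finrank K (B ⊓ F : Submodule K V))
    (hBU : finrank K (B ⊓ U : Submodule K V) < t) (hm : finrank K B + 1 = t + m)
    (hM : ∀ U' : Submodule K V, finrank K U' = finrank K U + 1 →
      {F ∈ 𝓕 | U' ≤ F}.ncard ≤ M) :
    𝓕.ncard ≤ qNum (Nat.card K) m * M := by
  have := finite_submodule K V
  obtain ⟨D, hDB, hUD, hD⟩ := exists_le_disjoint_finrank_add_eq U B
  obtain ⟨C, hCD, hC⟩ := exists_le_finrank_eq D (d := m) (by omega)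
  -- `C` is so large that every member of `𝓕` contains a point of it, which is not in `U`.
  have hpoint : ∀ F ∈ 𝓕, ∃ L ≤ (B ⊓ F) ⊓ C, finrank K L = 1 := by
    refine fun F hF => exists_le_finrank_eq _ ?_
    have hsup := Submodule.finrank_mono (sup_le (inf_le_left (b := F)) (hCD.trans hDB))
    have := Submodule.finrank_sup_add_finrank_inf_eq (B ⊓ F) C
    have := hB F hF
    omega
  calc 𝓕.ncard ≤ {L ∈ subspacesOfDim K V 1 | L ≤ C}.ncard * M := by
        refine ncard_le_ncard_mul_of_subset_biUnion (Set.toFinite _)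
          (f := fun L => {F ∈ 𝓕 | U ⊔ L ≤ F}) (fun F hF => ?_) fun L ⟨hL, hLC⟩ => hM _ ?_
        · obtain ⟨L, hL, hL1⟩ := hpoint F hF
          exact Set.mem_biUnion (x := L) ⟨hL1, hL.trans inf_le_right⟩
            ⟨hF, sup_le (hU F hF) (hL.trans (inf_le_left.trans inf_le_right))⟩
        · rw [finrank_sup_of_disjoint (hUD.mono_right (hLC.trans hCD)), hL]
    _ = qNum (Nat.card K) m * M := by
        rw [ncard_subspacesOfDim_le, ncard_subspacesOfDim_one, hC]

lemma IsAlmostCover.ncard_ge_le_qNum_add_one_mul {𝓕 : Set (Submodule K V)}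
    {U B : Submodule K V} {t m M : ℕ} (hB : IsAlmostCover t 𝓕 B)
    (hBU : finrank K (B ⊓ U : Submodule K V) < t) (hm : finrank K B + 1 = t + m) (hM₀ : 0 < M)
    (hM : ∀ U' : Submodule K V, finrank K U' = finrank K U + 1 →
      {F ∈ 𝓕 | U' ≤ F}.ncard ≤ M) :
    {F ∈ 𝓕 | U ≤ F}.ncard ≤ (qNum (Nat.card K) m + 1) * M := by
  have := finite_submodule K V
  calc {F ∈ 𝓕 | U ≤ F}.ncard
      ≤ {F ∈ {F ∈ 𝓕 | U ≤ F} | t ≤ finrank K (B ⊓ F : Submodule K V)}.ncard + 1 :=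
        (hB.mono (Set.sep_subset _ _)).ncard_le
    _ ≤ qNum (Nat.card K) m * M + M := by
        refine add_le_add ?_ hM₀
        refine ncard_le_qNum_mul_of_le_finrank_inf (fun F hF => hF.1.2) (fun F hF => hF.2)
          hBU hm fun U' hU' => ?_
        refine (Set.ncard_le_ncard ?_).trans (hM U' hU')
        exact fun F hF => ⟨hF.1.1.1, hF.2⟩
    _ = (qNum (Nat.card K) m + 1) * M := by ring

lemma IsAlmostTIntersecting.ncard_ge_le_pow_mul_gaussBinom {𝓕 : Set (Submodule K V)}
    {k t m ℓ r a : ℕ} (hint : IsAlmostTIntersecting t 𝓕) (h𝓕 : 𝓕 ⊆ subspacesOfDim K V k)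
    (hm : k + 1 = t + m)
    (hV : finrank K V = k + a) (hr : ℓ + r = k)
    (hbad : ∀ U : Submodule K V, t ≤ finrank K U → finrank K U < ℓ →
      ∃ B ∈ 𝓕, finrank K (U ⊓ B : Submodule K V) < t)
    {s : ℕ} {U : Submodule K V} (hs : finrank K U + s = ℓ) (hU : t ≤ finrank K U) :
    {F ∈ 𝓕 | U ≤ F}.ncard ≤
      (qNum (Nat.card K) m + 1) ^ s * gaussBinom (Nat.card K) r a := by
  have := finite_submodule K V
  induction s generalizing U with
  | zero =>
    rw [pow_zero, one_mul, ← ncard_subspacesOfDim_ge_eq_gaussBinom hV (hs ▸ hr)]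
    exact Set.ncard_le_ncard fun F hF => ⟨h𝓕 hF.1, hF.2⟩
  | succ s ih =>
    obtain ⟨B, hB, hUB⟩ := hbad U hU (by omega)
    rw [inf_comm] at hUB
    rw [pow_succ', mul_assoc]
    have hBk : finrank K B = k := h𝓕 hB
    refine IsAlmostCover.ncard_ge_le_qNum_add_one_mul (hint B hB) hUB (hBk ▸ hm)
      (mul_pos (by positivity) (gaussBinom_pos ..)) fun U' hU' => ih ?_ ?_ <;> omega

lemma IsAlmostCover.ncard_le_gaussBinom_mul {𝓕 : Set (Submodule K V)} {T : Submodule K V}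
    {t s M : ℕ} (hT : IsAlmostCover t 𝓕 T) (hs : finrank K T = t + s)
    (hM : ∀ E ∈ subspacesOfDim K V t, {F ∈ 𝓕 | E ≤ F}.ncard ≤ M) :
    𝓕.ncard ≤ gaussBinom (Nat.card K) t s * M + 1 := by
  have := finite_submodule K V
  refine hT.ncard_le.trans (Nat.add_le_add_right ?_ 1)
  rw [← ncard_subspacesOfDim hs, ← ncard_subspacesOfDim_le]
  refine ncard_le_ncard_mul_of_subset_biUnion (Set.toFinite _) (f := fun E => {F ∈ 𝓕 | E ≤ F})
    (fun F ⟨hF, hTF⟩ => ?_) fun E hE => hM E hE.1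
  obtain ⟨E, hE, hEt⟩ := exists_le_finrank_eq _ hTF
  exact Set.mem_biUnion (x := E) ⟨hEt, hE.trans inf_le_left⟩ ⟨hF, hE.trans inf_le_right⟩

lemma IsAlmostTIntersecting.exists_ncard_le_of_forall_not_le {𝓕 : Set (Submodule K V)}
    {k t a : ℕ} (hint : IsAlmostTIntersecting t 𝓕) (h𝓕 : 𝓕 ⊆ subspacesOfDim K V k)
    (hne : 𝓕.Nonempty) (hk : t + 1 ≤ k) (hV : finrank K V = k + a)
    (hcenter : ∀ E ∈ subspacesOfDim K V t, ∃ F ∈ 𝓕, ¬E ≤ F) :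
    ∃ j r, 1 ≤ j ∧ t + j + r = k ∧ 𝓕.ncard ≤
      1 + (qNum (Nat.card K) (t + 1) * (qNum (Nat.card K) (j + r + 1) + 1)) ^ j *
        gaussBinom (Nat.card K) r a := by
  obtain ⟨T, hT, htT, hTk, hmin⟩ := hint.exists_minimal_isAlmostCover h𝓕 hne hk
  obtain ⟨s, hs⟩ := Nat.exists_eq_add_of_le (Nat.le_of_succ_le htT)
  obtain ⟨r, rfl⟩ := Nat.exists_eq_add_of_le hTk
  have hbad (U : Submodule K V) (htU : t ≤ finrank K U) (hUT : finrank K U < finrank K T) :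
      ∃ B ∈ 𝓕, finrank K (U ⊓ B : Submodule K V) < t := by
    rcases htU.eq_or_lt with htU | htU
    · obtain ⟨B, hB, hUB⟩ := hcenter U htU.symm
      refine ⟨B, hB, htU ▸ Submodule.finrank_lt_finrank_of_lt (inf_lt_left.2 hUB)⟩
    · exact exists_finrank_inf_lt_of_not_isAlmostCover (hmin U htU hUT)
  refine ⟨s, r, by omega, by omega, ?_⟩
  calc 𝓕.ncard ≤ gaussBinom (Nat.card K) t s *
          ((qNum (Nat.card K) (s + r + 1) + 1) ^ s * gaussBinom (Nat.card K) r a) + 1 :=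
        hT.ncard_le_gaussBinom_mul hs fun E (hE : finrank K E = t) =>
          hint.ncard_ge_le_pow_mul_gaussBinom h𝓕 (by omega) hV rfl hbad (by omega) hE.ge
    _ ≤ qNum (Nat.card K) (t + 1) ^ s *
          ((qNum (Nat.card K) (s + r + 1) + 1) ^ s * gaussBinom (Nat.card K) r a) + 1 := by
        gcongr
        exact gaussBinom_le_qNum_pow t s
    _ = 1 + (qNum (Nat.card K) (t + 1) * (qNum (Nat.card K) (s + r + 1) + 1)) ^ s *
          gaussBinom (Nat.card K) r a := by rw [mul_pow, mul_assoc, add_comm]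

lemma IsMaximumAlmostTIntersecting.gaussBinom_le_ncard {𝓕 : Set (Submodule K V)} {k t r a : ℕ}
    (h𝓕 : IsMaximumAlmostTIntersecting k t 𝓕) (hV : finrank K V = k + a) (hr : t + r = k) :
    gaussBinom (Nat.card K) r a ≤ 𝓕.ncard := by
  obtain ⟨E, -, hE⟩ := exists_le_finrank_eq (⊤ : Submodule K V) (d := t) (by
    rw [finrank_top]
    omega)
  rw [← ncard_subspacesOfDim_ge_eq_gaussBinom hV (hE ▸ hr)]
  exact h𝓕.2.2 _ (Set.sep_subset _ _)
    (isTIntersecting_of_forall_le hE fun F hF => hF.2).isAlmostTIntersecting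

lemma IsMaximumAlmostTIntersecting.eq_of_forall_le {𝓕 : Set (Submodule K V)} {k t : ℕ}
    (h𝓕 : IsMaximumAlmostTIntersecting k t 𝓕) {E : Submodule K V} (hE : finrank K E = t)
    (h : ∀ F ∈ 𝓕, E ≤ F) : 𝓕 = {F ∈ subspacesOfDim K V k | E ≤ F} := by
  have := finite_submodule K V
  exact Set.eq_of_subset_of_ncard_le (fun F hF => ⟨h𝓕.1 hF, h F hF⟩) <|
    h𝓕.2.2 _ (Set.sep_subset _ _)
      (isTIntersecting_of_forall_le hE fun F hF => hF.2).isAlmostTIntersecting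

lemma IsMaximumAlmostTIntersecting.exists_forall_le {𝓕 : Set (Submodule K V)} {k t a : ℕ}
    (h𝓕 : IsMaximumAlmostTIntersecting k t 𝓕) (hk : t + 1 ≤ k) (hV : finrank K V = k + a)
    (ha : k + 1 ≤ a) (hcases : k = t + 1 ∨ 3 ≤ Nat.card K ∨ k + 2 ≤ a) :
    ∃ E ∈ subspacesOfDim K V t, ∀ F ∈ 𝓕, E ≤ F := by
  by_contra! hcenter
  have hne : 𝓕.Nonempty := by
    obtain ⟨r, hr⟩ := Nat.exists_eq_add_of_le (Nat.le_of_succ_le hk)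
    exact Set.nonempty_of_ncard_ne_zero
      ((gaussBinom_pos ..).trans_le (h𝓕.gaussBinom_le_ncard hV hr.symm)).ne'
  obtain ⟨j, r, hj, hjr, hle⟩ := h𝓕.2.1.exists_ncard_le_of_forall_not_le h𝓕.1 hne hk hV hcenter
  exact (h𝓕.gaussBinom_le_ncard hV (by omega : t + (r + j) = k)).not_gt <| hle.trans_lt <|
    one_add_qNum_pow_mul_gaussBinom_lt Finite.one_lt_card hj hjr ha hcases

end Families

end AlmostIntersecting

theorem theorem1p1 {K V : Type*} [Field K] [Finite K] [AddCommGroup V] [Module K V]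
    [FiniteDimensional K V] (q n k t : ℕ) (hq : Nat.card K = q) (hV : Module.finrank K V = n)
    (ht : 1 ≤ t) (hk : t + 1 ≤ k)
    (hn : 2 * k + 1 + AlmostIntersecting.delta 2 q *
      (1 - AlmostIntersecting.delta k (t + 1)) ≤ n)
    (𝓕 : Set (Submodule K V))
    (h𝓕 : AlmostIntersecting.IsMaximumAlmostTIntersecting k t 𝓕) :
    (∃ E ∈ AlmostIntersecting.subspacesOfDim K V t,
      𝓕 = {F ∈ AlmostIntersecting.subspacesOfDim K V k | E ≤ F}) ∧
    AlmostIntersecting.IsTIntersecting t 𝓕 := by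
  have hcard : 2 ≤ q := hq ▸ Finite.one_lt_card
  have hcodim : 2 * k + 1 ≤ n ∧ (k = t + 1 ∨ 3 ≤ q ∨ 2 * k + 2 ≤ n) := by
    unfold AlmostIntersecting.delta at hn
    split_ifs at hn <;> omega
  obtain ⟨a, rfl⟩ := Nat.exists_eq_add_of_le (show k ≤ n by omega)
  obtain ⟨E, hE, hle⟩ := h𝓕.exists_forall_le hk hV (by omega) (by omega)
  exact ⟨⟨E, hE, h𝓕.eq_of_forall_le hE hle⟩,
    AlmostIntersecting.isTIntersecting_of_forall_le hE hle⟩
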